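/- **Conventions.** Rings are commutative and unital. An $\ell$-algebra is an $\mathbb R$-algebra $A$ with a lattice order such that $a\le b$ implies $a+c\le b+c$, and $0\le a,b$ and $0\le r\in\mathbb R$ imply $0\le ab$ and $0\le ra$. It is *bounded* if for each $a\in A$ there is $n\in\mathbb N$ with $a\le n\cdot 1$, and *archimedean* if $na\le b$ for all $n\in\mathbb N$ implies $a\le 0$. Real numbers $r$ are identified with $r\cdot 1\in A$, and $a^+=a\vee 0$, $|a|=a\vee(-a)$. $A$ is *uniformly complete* if it is complete for the norm $\|a\|=\inf\{r\in\mathbb R: |a|\le r\cdot 1\}$. A *modal operator* on a bounded archimedean $\ell$-algebra $A$ is a map $\Box:A\to A$ such that for all $a,b\in A$, $r\in\mathbb R$: $\Box(a\wedge b)=\Box a\wedge\Box b$; $\Box r=r+(1-r)\Box 0$; $\Box(a^+)=(\Box a)^+$; $\Box(a+r)=\Box a+\Box r-\Box 0$; and $\Box(ra)=(\Box r)(\Box a)$ if $r\ge 0$. Let $\boldsymbol{\mathit{mba}\ell}^{\sf D}$ be the category of pairs $(A,\Box)$ with $A$ a bounded archimedean $\ell$-algebra and $\Box$ a modal operator on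 $A$ with $\Box 0=0$; morphisms are the unital $\mathbb R$-algebra and lattice homomorphisms that preserve $\Box$. Let $\boldsymbol{\mathit{muba}\ell}^{\sf D}$ be its full subcategory of those $(A,\Box)$ with $A$ uniformly complete. For a binary relation $R$ on $X$ write $R[x]=\{y: xRy\}$ and $R^{-1}[S]=\{x: xRy\text{ for some }y\in S\}$. Let ${\sf KHF}^{\sf D}$ be the category of pairs $(X,R)$ with $X$ a compact Hausdorff space and $R$ a binary relation on $X$ that is *continuous* (each $R[x]$ is closed, $R^{-1}[F]$ is closed for $F$ closed, and $R^{-1}[U]$ is open for $U$ open) and *serial* ($R[x]\neq\varnothing$ for all $x$); morphisms $(X,R)\to(Y,S)$ are the continuous maps $f$ with $f(R[x])=S[f(x)]$ for all $x\in X$. An ideal $I$ of $A$ is an *$\ell$-ideal* if $|a|\le|b|$ and $b\in I$ imply $a\in I$. Let $Y_A$ be the set of maximal (proper) $\ell$-ideals of $A$ with the topology whose closed sets are exactly the sets $\{M\in Y_A: I\subseteq M\}$, $I$ an $\ell$-ideal of $A$. **Theorem.** The assignments - $\mathsf Y(A,\Box)=(Y_A,R_\Box)$, where $xR_\Box y$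 iff $\Box a\in x$ for all $0\le a\in y$, and $\mathsf Y(\alpha)(M)=\alpha^{-1}(M)$ for morphisms $\alpha$; - $\mathsf C(X,R)=(C(X,\mathbb R),\Box_R)$ with pointwise operations and order, where $(\Box_Rf)(x)=\inf\{f(y): y\in R[x]\}$, and $\mathsf C(\varphi)(f)=f\circ\varphi$ for morphisms $\varphi$ define contravariant functors between $\boldsymbol{\mathit{mba}\ell}^{\sf D}$ and ${\sf KHF}^{\sf D}$. They form a dual adjunction between $\boldsymbol{\mathit{mba}\ell}^{\sf D}$ and ${\sf KHF}^{\sf D}$ (that is, $\mathsf Y:\boldsymbol{\mathit{mba}\ell}^{\sf D}\to({\sf KHF}^{\sf D})^{\rm op}$ is left adjoint to $\mathsf C:({\sf KHF}^{\sf D})^{\rm op}\to\boldsymbol{\mathit{mba}\ell}^{\sf D}$), whose unit sends $a\in A$ to the function $\zeta_A(a)\in C(Y_A)$, $\zeta_A(a)(M)$ being the real number $r$ with $a-r\in M$, and whose counit is given by the maps $X\to Y_{C(X)}$, $x\mapsto\{f\in C(X): f(x)=0\}$. The functor $\mathsf C$ takes values in $\boldsymbol{\mathit{muba}\ell}^{\sf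 D}$, and the adjunction restricts to a dual equivalence between $\boldsymbol{\mathit{muba}\ell}^{\sf D}$ and ${\sf KHF}^{\sf D}$. -/

import Mathlib

open CategoryTheory Opposite

universe u

namespace ModalGelfand

/-! ### Bounded archimedean lattice-ordered algebras -/

/-- A commutative unital `ℝ`-algebra with a lattice order is a bounded archimedean `ℓ`-algebra. -/
class IsBal (A : Type u) [CommRing A] [Lattice A] [Algebra ℝ A] : Prop where
  add_le_add : ∀ a b c : A, a ≤ b → a + c ≤ b + c
  mul_nonneg : ∀ a b : A, 0 ≤ a → 0 ≤ b → 0 ≤ a * b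
  smul_nonneg : ∀ (r : ℝ) (a : A), 0 ≤ r → 0 ≤ a → 0 ≤ r • a
  bounded : ∀ a : A, ∃ n : ℕ, a ≤ n • (1 : A)
  archimedean : ∀ a b : A, (∀ n : ℕ, n • a ≤ b) → a ≤ 0

/-- The norm `‖a‖ = inf {r ∈ ℝ | |a| ≤ r · 1}`. -/
noncomputable def unifNorm {A : Type u} [CommRing A] [Lattice A] [Algebra ℝ A] (a : A) : ℝ :=
  sInf {r : ℝ | |a| ≤ r • (1 : A)}

/-- Every sequence that is Cauchy for the norm `unifNorm` converges for it. -/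
def IsUniformlyComplete (A : Type u) [CommRing A] [Lattice A] [Algebra ℝ A] : Prop :=
  ∀ s : ℕ → A,
    (∀ ε : ℝ, 0 < ε → ∃ N : ℕ, ∀ m n : ℕ, N ≤ m → N ≤ n → unifNorm (s m - s n) < ε) →
    ∃ a : A, ∀ ε : ℝ, 0 < ε → ∃ N : ℕ, ∀ n : ℕ, N ≤ n → unifNorm (s n - a) < ε

/-! ### Modal operators and the category of modal bounded archimedean `ℓ`-algebras -/

/-- Modal operators; a real number `r` is identified with `r · 1`, and `a⁺` is `a ⊔ 0`. -/
structure IsModalOperator {A : Type u} [CommRing A] [Lattice A] [Algebra ℝ A]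
    (box : A → A) : Prop where
  map_inf : ∀ a b : A, box (a ⊓ b) = box a ⊓ box b
  map_real : ∀ r : ℝ,
    box (algebraMap ℝ A r) = algebraMap ℝ A r + (1 - algebraMap ℝ A r) * box 0
  map_pos : ∀ a : A, box (a ⊔ 0) = box a ⊔ 0
  map_add_real : ∀ (a : A) (r : ℝ),
    box (a + algebraMap ℝ A r) = box a + box (algebraMap ℝ A r) - box 0
  map_smul : ∀ (r : ℝ) (a : A), 0 ≤ r → box (r • a) = box (algebraMap ℝ A r) * box a

/-- Modal bounded archimedean `ℓ`-algebras. -/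
structure MBal : Type (u + 1) where
  carrier : Type u
  [commRing : CommRing carrier]
  [lattice : Lattice carrier]
  [algebra : Algebra ℝ carrier]
  [isBal : IsBal carrier]
  box : carrier → carrier
  isModal : IsModalOperator box

attribute [instance] MBal.commRing MBal.lattice MBal.algebra MBal.isBal

/-- Unital `ℓ`-algebra morphisms that preserve the modal operator. -/
@[ext]
structure MBal.Hom (A B : MBal.{u}) : Type u where
  toAlgHom : A.carrier →ₐ[ℝ] B.carrier
  map_sup : ∀ a b : A.carrier, toAlgHom (a ⊔ b) = toAlgHom a ⊔ toAlgHom b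
  map_inf : ∀ a b : A.carrier, toAlgHom (a ⊓ b) = toAlgHom a ⊓ toAlgHom b
  map_box : ∀ a : A.carrier, toAlgHom (A.box a) = B.box (toAlgHom a)

instance : Category.{u} MBal.{u} where
  Hom A B := MBal.Hom A B
  id A := ⟨AlgHom.id ℝ A.carrier, fun _ _ => rfl, fun _ _ => rfl, fun _ => rfl⟩
  comp f g := ⟨g.toAlgHom.comp f.toAlgHom,
    fun a b => by simp [f.map_sup, g.map_sup],
    fun a b => by simp [f.map_inf, g.map_inf],
    fun a => by simp [f.map_box, g.map_box]⟩

/-- The condition `□ 0 = 0`. -/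
def mbalD : ObjectProperty MBal.{u} := fun A => A.box 0 = 0

/-- The full subcategory of modal bounded archimedean `ℓ`-algebras with `□ 0 = 0`. -/
abbrev MBalD : Type (u + 1) := mbalD.{u}.FullSubcategory

/-- The underlying type of an object of `MBalD`. -/
abbrev MBalD.alg (A : MBalD.{u}) : Type u := A.obj.carrier

/-- Uniform completeness of the underlying algebra. -/
def mubalD : ObjectProperty MBalD.{u} := fun A => IsUniformlyComplete A.alg

/-- The full subcategory of `MBalD` on the uniformly complete algebras. -/
abbrev MUBalD : Type (u + 1) := mubalD.{u}.FullSubcategory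

/-! ### Compact Hausdorff frames -/

/-- Continuous relations; `{y | R x y}` is `R[x]` and `{x | ∃ y ∈ S, R x y}` is `R⁻¹[S]`. -/
structure IsContinuousRel {X : Type u} [TopologicalSpace X] (R : X → X → Prop) : Prop where
  isClosed_image : ∀ x : X, IsClosed {y | R x y}
  isClosed_preimage : ∀ F : Set X, IsClosed F → IsClosed {x | ∃ y ∈ F, R x y}
  isOpen_preimage : ∀ U : Set X, IsOpen U → IsOpen {x | ∃ y ∈ U, R x y}

/-- Compact Hausdorff frames. -/
structure KHF : Type (u + 1) where
  carrier : Type u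
  [topologicalSpace : TopologicalSpace carrier]
  [compactSpace : CompactSpace carrier]
  [t2Space : T2Space carrier]
  rel : carrier → carrier → Prop
  isContinuousRel : IsContinuousRel rel

attribute [instance] KHF.topologicalSpace KHF.compactSpace KHF.t2Space

/-- Continuous bounded morphisms: `f (R[x]) = S[f x]`. -/
@[ext]
structure KHF.Hom (X Y : KHF.{u}) : Type u where
  toMap : C(X.carrier, Y.carrier)
  image_rel : ∀ x : X.carrier, toMap '' {x' | X.rel x x'} = {y | Y.rel (toMap x) y}

instance : Category.{u} KHF.{u} where
  Hom X Y := KHF.Hom X Y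
  id X := ⟨ContinuousMap.id X.carrier, fun _ => by simp⟩
  comp f g := ⟨g.toMap.comp f.toMap, fun x => by
    rw [ContinuousMap.coe_comp, Set.image_comp, f.image_rel, g.image_rel]; rfl⟩

/-- Seriality: `R[x] ≠ ∅` for all `x`. -/
def khfD : ObjectProperty KHF.{u} := fun X => ∀ x : X.carrier, ∃ y : X.carrier, X.rel x y

/-- The full subcategory of compact Hausdorff frames with a serial relation. -/
abbrev KHFD : Type (u + 1) := khfD.{u}.FullSubcategory

/-- The underlying space of an object of `KHFD`. -/
abbrev KHFD.space (X : KHFD.{u}) : Type u := X.obj.carrier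

/-! ### Maximal `ℓ`-ideals -/

/-- An ideal `I` is an `ℓ`-ideal if `|a| ≤ |b|` and `b ∈ I` imply `a ∈ I`. -/
def IsLIdeal {A : Type u} [CommRing A] [Lattice A] (I : Ideal A) : Prop :=
  ∀ a b : A, |a| ≤ |b| → b ∈ I → a ∈ I

/-- The set of maximal `ℓ`-ideals, that is, the maximal elements among the proper `ℓ`-ideals. -/
def MaxLIdeal (A : Type u) [CommRing A] [Lattice A] : Type u :=
  {I : Ideal A // Maximal (fun J : Ideal A => IsLIdeal J ∧ J ≠ ⊤) I}

/-! ### Concrete descriptions of the two contravariant functors -/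

/-- An identification of a contravariant functor `Y` with the Yosida functor
`(A, □) ↦ (Y_A, R_□)`, `α ↦ α⁻¹`. -/
structure YosidaPresentation (Y : MBalD.{u} ⥤ KHFD.{u}ᵒᵖ) : Type (u + 1) where
  /-- the points of `Y(A, □)` are the maximal `ℓ`-ideals of `A` -/
  points : ∀ A : MBalD.{u}, (Y.obj A).unop.space ≃ MaxLIdeal A.alg
  /-- the closed sets are exactly the sets `{M | I ⊆ M}` with `I` an `ℓ`-ideal -/
  isClosed_iff : ∀ (A : MBalD.{u}) (S : Set (Y.obj A).unop.space),
    IsClosed S ↔ ∃ I : Ideal A.alg, IsLIdeal I ∧ S = {x | I ≤ (points A x).1}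
  /-- `x R_□ y` iff `□ a ∈ x` for all `0 ≤ a ∈ y` -/
  rel_iff : ∀ (A : MBalD.{u}) (x y : (Y.obj A).unop.space),
    (Y.obj A).unop.obj.rel x y ↔
      ∀ a : A.alg, 0 ≤ a → a ∈ (points A y).1 → A.obj.box a ∈ (points A x).1
  /-- a morphism `α` goes to the map `M ↦ α⁻¹(M)` -/
  map_points : ∀ {A B : MBalD.{u}} (α : A ⟶ B) (x : (Y.obj B).unop.space) (a : A.alg),
    a ∈ (points A ((Y.map α).unop.hom.toMap x)).1 ↔ α.hom.toAlgHom a ∈ (points B x).1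

/-- An identification of a contravariant functor `C` with the functor
`(X, R) ↦ (C(X), □_R)`, `φ ↦ (- ∘ φ)`. Since `R` is serial,
`(□_R f)(x)` is the infimum of `f` over the nonempty set `R[x]`. -/
structure FunctionPresentation (C : KHFD.{u}ᵒᵖ ⥤ MBalD.{u}) : Type (u + 1) where
  /-- the algebra underlying `C(X, R)` is `C(X)` -/
  functions : ∀ X : KHFD.{u}, (C.obj (op X)).alg ≃ₐ[ℝ] C(X.space, ℝ)
  /-- the order is the pointwise one -/
  le_iff : ∀ (X : KHFD.{u}) (f g : (C.obj (op X)).alg),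
    f ≤ g ↔ functions X f ≤ functions X g
  /-- `(□_R f)(x) = inf f (R[x])` -/
  box_apply : ∀ (X : KHFD.{u}) (f : (C.obj (op X)).alg) (x : X.space),
    functions X ((C.obj (op X)).obj.box f) x = sInf (functions X f '' {y | X.obj.rel x y})
  /-- a morphism `φ` goes to composition with `φ` -/
  map_functions : ∀ {X X' : KHFD.{u}} (φ : X ⟶ X') (f : (C.obj (op X')).alg),
    functions X ((C.map φ.op).hom.toAlgHom f) = (functions X' f).comp φ.hom.toMap

/-- If the right adjoint takes values in a full subcategory of its target, the adjunction restricts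
to that subcategory. -/
noncomputable def restrictAdjunction {C D : Type*} [Category C] [Category D] {L : C ⥤ D}
    {R : D ⥤ C} (adj : L ⊣ R) (P : ObjectProperty C) (hR : ∀ X : D, P (R.obj X)) :
    P.ι ⋙ L ⊣ P.lift R hR :=
  adj.restrictFullyFaithful (L := P.ι ⋙ L) (R := P.lift R hR)
    P.fullyFaithfulι (Functor.FullyFaithful.id D) (Iso.refl _) (Iso.refl _)

end ModalGelfand

open ModalGelfand

namespace ModalGelfand

section Bal

variable {A : Type u} [CommRing A] [Lattice A] [Algebra ℝ A]

/-! ### Order-theoretic preliminaries -/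

/-! This is Gelfand–Yosida duality carrying a relation. Modulo a maximal ℓ-ideal every element is a
real constant (`exists_sub_algebraMap_mem`), so maximal ℓ-ideals are the same as characters
(`equivMaxLIdeal`). Characters form a closed subset of a product of intervals, hence a compact
Hausdorff space. By the archimedean axiom they determine the order, so the Gelfand transform is an
isometric embedding. Its image is dense by Stone–Weierstrass, so it is onto when `A` is uniformly
complete.

On characters, `R_□` reads `φ (□a) ≤ ψ a` for all `a`. The heart of the proof is
`exists_modalRel_forall_apply_eq_zero`, which finds a successor of `φ` killing a given cone on which
`φ ∘ □ ≤ 0`. Applied to the multiples of `(a - φ (□a))⁺`, it shows that `φ (□a)` is the minimum of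
`a` over `R_□[φ]`. This yields seriality, openness of preimages of open sets, and compatibility of
the unit with `□`. Applied to the image of the positive part of a kernel, it shows that
homomorphisms induce bounded morphisms.

Conversely, every character of `C(X)` is an evaluation, and closedness of `R[x]` recovers `R` from
`□_R`. Hence the counit is always an isomorphism, and the unit is one on uniformly complete
algebras. -/

instance (priority := 50) IsBal.isOrderedRing [IsBal A] : IsOrderedRing A :=
  haveI : IsOrderedAddMonoid A :=
    ⟨fun a b h c => IsBal.add_le_add a b c h,
      fun a b h c => by simpa only [add_comm c] using IsBal.add_le_add a b c h⟩
  { zero_le_one := by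
      -- Positivity of `1` is not an axiom: `0 ≤ |1| ≤ n • 1` can be divided by `n`, and if `n = 0`
      -- then `-1 ≤ |1| ≤ 0`.
      obtain ⟨n, hn⟩ := IsBal.bounded |(1 : A)|
      have h1 : (0 : A) ≤ n • (1 : A) := (abs_nonneg _).trans hn
      rcases Nat.eq_zero_or_pos n with rfl | hpos
      · rw [zero_smul] at hn
        exact ((le_abs_self (-1 : A)).trans (by rwa [abs_neg])) |> neg_nonpos.mp
      · have h2 := IsBal.smul_nonneg ((n : ℝ)⁻¹) _ (by positivity) h1
        rwa [← Nat.cast_smul_eq_nsmul ℝ, smul_smul, inv_mul_cancel₀ (by positivity),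
          one_smul] at h2
    mul_le_mul_of_nonneg_left := fun a ha b c h => by
      rw [← sub_nonneg, ← mul_sub]
      exact IsBal.mul_nonneg _ _ ha (sub_nonneg.2 h)
    mul_le_mul_of_nonneg_right := fun a ha b c h => by
      rw [← sub_nonneg, ← sub_mul]
      exact IsBal.mul_nonneg _ _ (sub_nonneg.2 h) ha }

variable [IsBal A]

instance (priority := 50) IsBal.posSMulMono : PosSMulMono ℝ A :=
  ⟨fun r hr a b h => by
    rw [← sub_nonneg, ← smul_sub]
    exact IsBal.smul_nonneg r _ hr (sub_nonneg.2 h)⟩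

theorem smul_inf_of_pos {r : ℝ} (hr : 0 < r) (a b : A) : r • (a ⊓ b) = r • a ⊓ r • b :=
  (OrderIso.smulRight hr).map_inf a b

theorem succ_nsmul_inf (n : ℕ) (a b : A) : (n + 1) • (a ⊓ b) = (n + 1) • a ⊓ (n + 1) • b := by
  simpa only [Nat.cast_smul_eq_nsmul] using
    smul_inf_of_pos (r := ((n + 1 : ℕ) : ℝ)) (by positivity) a b

theorem algebraMap_nonneg {r : ℝ} (hr : 0 ≤ r) : 0 ≤ algebraMap ℝ A r := by
  rw [Algebra.algebraMap_eq_smul_one]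
  exact IsBal.smul_nonneg r 1 hr zero_le_one

theorem algebraMap_le_algebraMap {r s : ℝ} (h : r ≤ s) :
    algebraMap ℝ A r ≤ algebraMap ℝ A s := by
  rw [← sub_nonneg, ← map_sub]
  exact algebraMap_nonneg (sub_nonneg.2 h)

theorem algebraMap_sup (r s : ℝ) :
    algebraMap ℝ A (r ⊔ s) = algebraMap ℝ A r ⊔ algebraMap ℝ A s :=
  (show Monotone (algebraMap ℝ A) from fun _ _ h => algebraMap_le_algebraMap h).map_sup r s

omit [Lattice A] [IsBal A] in
theorem algebraMap_natCast_mul (n : ℕ) (r : ℝ) :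
    algebraMap ℝ A (n * r) = n • algebraMap ℝ A r := by
  rw [map_mul, map_natCast, nsmul_eq_mul]

theorem exists_abs_le_algebraMap (a : A) : ∃ r : ℝ, 0 ≤ r ∧ |a| ≤ algebraMap ℝ A r := by
  obtain ⟨n, hn⟩ := IsBal.bounded |a|
  exact ⟨n, n.cast_nonneg, by simpa using hn⟩

theorem nonneg_of_two_nsmul_nonneg {a : A} (h : 0 ≤ 2 • a) : 0 ≤ a := by
  have h2 := IsBal.smul_nonneg ((2 : ℝ)⁻¹) _ (by norm_num) h
  rwa [← Nat.cast_smul_eq_nsmul ℝ, smul_smul, Nat.cast_ofNat,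
    inv_mul_cancel₀ (by norm_num), one_smul] at h2

/-- Rests on `2(|c||d| - cd) = (|c| - c)(|d| + d) + (|c| + c)(|d| - d)`, a sum of products of
nonnegative elements. -/
theorem abs_mul_le (a b : A) : |a * b| ≤ |a| * |b| := by
  have key : ∀ c d : A, c * d ≤ |c| * |d| := fun c d => by
    have h1 := IsBal.mul_nonneg _ _ (sub_nonneg.2 (le_abs_self c)) (by
      simpa using sub_nonneg.2 (neg_le_abs d) : 0 ≤ |d| + d)
    have h2 := IsBal.mul_nonneg _ _ (by
      simpa using sub_nonneg.2 (neg_le_abs c) : 0 ≤ |c| + c) (sub_nonneg.2 (le_abs_self d))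
    rw [← sub_nonneg]
    refine nonneg_of_two_nsmul_nonneg ?_
    convert add_nonneg h1 h2 using 1
    rw [two_nsmul]
    ring
  refine sup_le (key a b) ?_
  rw [← neg_mul, ← abs_neg a]
  exact key (-a) b

/-! ### `ℓ`-ideals -/

/-- The `ℓ`-ideal generated by an additive submonoid of nonnegative elements. -/
def coneIdeal (P : AddSubmonoid A) : Ideal A where
  carrier := {c | ∃ p ∈ P, |c| ≤ p}
  zero_mem' := ⟨0, P.zero_mem, by simp⟩
  add_mem' := by
    rintro a b ⟨p, hp, hap⟩ ⟨q, hq, hbq⟩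
    exact ⟨p + q, P.add_mem hp hq, (abs_add_le a b).trans (add_le_add hap hbq)⟩
  smul_mem' := by
    rintro d c ⟨p, hp, hcp⟩
    obtain ⟨n, hn⟩ := IsBal.bounded |d|
    refine ⟨n • p, P.nsmul_mem hp n, ?_⟩
    -- Boundedness replaces multiplication by `d` with an integer multiple, so additive closure of
    -- `P` suffices.
    calc |d * c| ≤ |d| * |c| := abs_mul_le d c
      _ ≤ (n • (1 : A)) * |c| := mul_le_mul_of_nonneg_right hn (abs_nonneg c)
      _ = n • |c| := by simp
      _ ≤ n • p := nsmul_le_nsmul_right hcp n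

theorem isLIdeal_coneIdeal (P : AddSubmonoid A) : IsLIdeal (coneIdeal P) := by
  rintro a b hab ⟨p, hp, hbp⟩
  exact ⟨p, hp, hab.trans hbp⟩

theorem mem_coneIdeal_of_nonneg {P : AddSubmonoid A} {c : A} (hc : 0 ≤ c) (h : c ∈ P) :
    c ∈ coneIdeal P :=
  ⟨c, h, (abs_of_nonneg hc).le⟩

namespace IsLIdeal

variable {I : Ideal A}

omit [Algebra ℝ A] [IsBal A] in
theorem abs_mem_iff [IsOrderedAddMonoid A] (hI : IsLIdeal I) {a : A} : |a| ∈ I ↔ a ∈ I :=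
  ⟨hI _ _ (abs_abs a).ge, hI _ _ (abs_abs a).le⟩

theorem mem_of_le (hI : IsLIdeal I) {a b : A} (ha : 0 ≤ a) (hab : a ≤ b) (hb : b ∈ I) : a ∈ I :=
  hI a b (by rwa [abs_of_nonneg ha, abs_of_nonneg (ha.trans hab)]) hb

theorem mem_of_abs_le (hI : IsLIdeal I) {a b : A} (hab : |a| ≤ b) (hb : b ∈ I) : a ∈ I :=
  hI.abs_mem_iff.1 (hI.mem_of_le (abs_nonneg a) hab hb)

end IsLIdeal

omit [Lattice A] [IsBal A] in
theorem algebraMap_notMem {I : Ideal A} (hI : I ≠ ⊤) {r : ℝ} (hr : r ≠ 0) :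
    algebraMap ℝ A r ∉ I :=
  fun h => hI (I.eq_top_of_isUnit_mem h (IsUnit.map _ (isUnit_iff_ne_zero.2 hr)))

omit [Algebra ℝ A] [IsBal A] in
theorem exists_le_maximal_lideal {I : Ideal A} (hI : IsLIdeal I) (hne : I ≠ ⊤) :
    ∃ M : Ideal A, I ≤ M ∧ Maximal (fun J : Ideal A => IsLIdeal J ∧ J ≠ ⊤) M := by
  refine zorn_le_nonempty₀ {J : Ideal A | IsLIdeal J ∧ J ≠ ⊤} ?_ I ⟨hI, hne⟩
  intro c hc hchain J hJ
  refine ⟨sSup c, ⟨?_, ?_⟩, fun K hK => le_sSup hK⟩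
  · intro a b hab hb
    rw [Submodule.mem_sSup_of_directed ⟨J, hJ⟩ hchain.directedOn] at hb ⊢
    obtain ⟨K, hK, hbK⟩ := hb
    exact ⟨K, hK, (hc hK).1 a b hab hbK⟩
  · rw [Ne, Ideal.eq_top_iff_one, Submodule.mem_sSup_of_directed ⟨J, hJ⟩ hchain.directedOn]
    rintro ⟨K, hK, h1⟩
    exact (hc hK).2 ((Ideal.eq_top_iff_one K).2 h1)

/-! ### The quotient by a maximal ℓ-ideal is `ℝ` -/

section Maximal

variable {M : Ideal A} (hM : Maximal (fun J : Ideal A => IsLIdeal J ∧ J ≠ ⊤) M)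

include hM

/-- By maximality the ℓ-ideal generated by `M` and `a` contains `1`, so `1` lies below an element of
the cone `M⁺ + ℕa`. -/
theorem exists_one_le_of_notMem {a : A} (ha : 0 ≤ a) (haM : a ∉ M) :
    ∃ m ∈ M, 0 ≤ m ∧ ∃ n : ℕ, 1 ≤ m + n • a := by
  let P : AddSubmonoid A :=
    { carrier := {x | ∃ m ∈ M, 0 ≤ m ∧ ∃ n : ℕ, x = m + n • a}
      zero_mem' := ⟨0, M.zero_mem, le_rfl, 0, by simp⟩
      add_mem' := by
        rintro _ _ ⟨m, hm, hm0, n, rfl⟩ ⟨m', hm', hm0', n', rfl⟩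
        exact ⟨m + m', M.add_mem hm hm', add_nonneg hm0 hm0', n + n', by
          rw [add_smul]; abel⟩ }
  have hle : M ≤ coneIdeal P := fun m hm =>
    ⟨|m|, ⟨|m|, hM.prop.1.abs_mem_iff.2 hm, abs_nonneg m, 0, by simp⟩, le_rfl⟩
  have haP : a ∈ coneIdeal P := mem_coneIdeal_of_nonneg ha ⟨0, M.zero_mem, le_rfl, 1, by simp⟩
  have htop : coneIdeal P = ⊤ := by
    by_contra hne
    exact haM (hM.le_of_ge ⟨isLIdeal_coneIdeal P, hne⟩ hle haP)
  obtain ⟨p, ⟨m, hm, hm0, n, rfl⟩, h1⟩ := (Ideal.eq_top_iff_one _).1 htop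
  exact ⟨m, hm, hm0, n, (le_abs_self 1).trans h1⟩

theorem inf_notMem_of_notMem {a b : A} (ha : 0 ≤ a) (hb : 0 ≤ b) (haM : a ∉ M) (hbM : b ∉ M) :
    a ⊓ b ∉ M := by
  intro hab
  obtain ⟨m, hm, hm0, k, hk⟩ := exists_one_le_of_notMem hM ha haM
  obtain ⟨m', hm', hm0', k', hk'⟩ := exists_one_le_of_notMem hM hb hbM
  -- The `+ 1` puts the multiplier in the form required by `succ_nsmul_inf`.
  have h1 : (1 : A) ≤ m + m' + (k + k' + 1) • (a ⊓ b) := by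
    rw [succ_nsmul_inf, add_inf]
    refine le_inf (hk.trans ?_) (hk'.trans ?_)
    · exact add_le_add (le_add_of_nonneg_right hm0') (nsmul_le_nsmul_left ha (by lia))
    · exact add_le_add (le_add_of_nonneg_left hm0) (nsmul_le_nsmul_left hb (by lia))
  refine hM.prop.2 ((Ideal.eq_top_iff_one M).2 (hM.prop.1.mem_of_le zero_le_one h1 ?_))
  exact M.add_mem (M.add_mem hm hm') (M.nsmul_mem hab _)

/-- A Dedekind cut: `S` consists of the reals lying below `a` modulo `M`, and its supremum is the
value of `a`. -/
theorem exists_sub_algebraMap_mem (a : A) : ∃ r : ℝ, a - algebraMap ℝ A r ∈ M := by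
  have hL := hM.prop.1
  set S : Set ℝ := {s | (algebraMap ℝ A s - a)⁺ ∈ M}
  obtain ⟨t, -, ht⟩ := exists_abs_le_algebraMap a
  have hne : S.Nonempty := by
    refine ⟨-t, ?_⟩
    have : (algebraMap ℝ A (-t) - a)⁺ = 0 := by
      rw [posPart_eq_zero, map_neg, sub_nonpos]
      exact neg_le.1 ((neg_le_abs a).trans ht)
    exact (congrArg (· ∈ M) this).mpr M.zero_mem
  have hbdd : BddAbove S := by
    refine ⟨t, fun s hs => ?_⟩
    by_contra! hts
    refine algebraMap_notMem (A := A) hM.prop.2 (sub_pos.2 hts).ne'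
      (hL.mem_of_le (algebraMap_nonneg (sub_pos.2 hts).le) ?_ hs)
    rw [map_sub]
    exact (sub_le_sub_left ((le_abs_self a).trans ht) _).trans (le_posPart _)
  refine ⟨sSup S, ?_⟩
  set r := sSup S
  have hlow : ∀ ε : ℝ, 0 < ε → (algebraMap ℝ A (r - ε) - a)⁺ ∈ M := by
    intro ε hε
    obtain ⟨s, hs, hrs⟩ := exists_lt_of_lt_csSup hne (sub_lt_self r hε)
    exact hL.mem_of_le (posPart_nonneg _)
      (posPart_mono (sub_le_sub_right (algebraMap_le_algebraMap hrs.le) _)) hs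
  have hup : ∀ ε : ℝ, 0 < ε → (a - algebraMap ℝ A (r + ε))⁺ ∈ M := by
    intro ε hε
    -- The positive and negative parts of `r + ε - a` meet in `0`, so primeness puts one of them in
    -- `M`; the first is excluded because `r + ε` exceeds the supremum.
    have h1 : (algebraMap ℝ A (r + ε) - a)⁺ ∉ M := fun h =>
      (lt_add_of_pos_right r hε).not_ge (le_csSup hbdd h)
    by_contra h2
    refine inf_notMem_of_notMem hM (posPart_nonneg _) (posPart_nonneg _) h1 h2 ?_
    rw [← neg_sub (algebraMap ℝ A (r + ε)) a, posPart_neg, posPart_inf_negPart_eq_zero]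
    exact M.zero_mem
  by_contra hcon
  rw [← hL.abs_mem_iff] at hcon
  obtain ⟨m, hm, hm0, n, hn⟩ := exists_one_le_of_notMem hM (abs_nonneg _) hcon
  -- Chosen so that `n * ε ≤ 1 / 2`: half of the unit then remains below an element of `M`.
  set ε : ℝ := 1 / (2 * (n + 1)) with hε
  have hε0 : 0 < ε := by positivity
  have hnε : (n : ℝ) * ε ≤ 1 / 2 := by
    rw [hε, mul_one_div, div_le_div_iff₀ (by positivity) (by positivity)]
    nlinarith
  set p := (algebraMap ℝ A (r - ε) - a)⁺ with hp
  set q := (a - algebraMap ℝ A (r + ε))⁺ with hq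
  have habs : |a - algebraMap ℝ A r| ≤ algebraMap ℝ A ε + (p + q) := by
    refine sup_le ?_ ?_
    · have h1 : a - algebraMap ℝ A (r + ε) ≤ p + q :=
        (le_posPart _).trans (le_add_of_nonneg_left (posPart_nonneg _))
      rw [map_add, ← sub_sub, sub_le_iff_le_add] at h1
      rwa [add_comm]
    · have h1 : algebraMap ℝ A (r - ε) - a ≤ p + q :=
        (le_posPart _).trans (le_add_of_nonneg_right (posPart_nonneg _))
      rw [map_sub, sub_right_comm, sub_le_iff_le_add] at h1
      rwa [neg_sub, add_comm]
  have hfin : algebraMap ℝ A (1 / 2) ≤ m + n • (p + q) := by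
    have h2 : (1 : A) = algebraMap ℝ A (1 / 2) + algebraMap ℝ A (1 / 2) := by
      rw [← map_add]; norm_num
    have h3 : (1 : A) ≤ algebraMap ℝ A (1 / 2) + (m + n • (p + q)) := calc
      (1 : A) ≤ m + n • |a - algebraMap ℝ A r| := hn
      _ ≤ m + n • (algebraMap ℝ A ε + (p + q)) := by gcongr
      _ = algebraMap ℝ A (n * ε) + (m + n • (p + q)) := by
        rw [algebraMap_natCast_mul, nsmul_add]; abel
      _ ≤ _ := by gcongr
    exact le_of_add_le_add_left (h2 ▸ h3)
  exact algebraMap_notMem (A := A) hM.prop.2 (by norm_num)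
    (hL.mem_of_le (algebraMap_nonneg (by norm_num)) hfin
      (M.add_mem hm (M.nsmul_mem (M.add_mem (hlow ε hε0) (hup ε hε0)) n)))

end Maximal

end Bal

/-! ### Real characters and their space -/

/-- Unital lattice and algebra homomorphisms to `ℝ`. -/
structure Character (A : Type u) [CommRing A] [Lattice A] [Algebra ℝ A] extends A →ₐ[ℝ] ℝ where
  map_sup' : ∀ a b : A, toFun (a ⊔ b) = toFun a ⊔ toFun b

namespace Character

section

variable {A : Type u} [CommRing A] [Lattice A] [Algebra ℝ A]

instance : FunLike (Character A) A ℝ where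
  coe φ := φ.toAlgHom
  coe_injective φ ψ h := by
    cases φ; cases ψ
    congr
    exact DFunLike.coe_injective h

instance : AlgHomClass (Character A) ℝ A ℝ where
  map_add φ := map_add φ.toAlgHom
  map_mul φ := map_mul φ.toAlgHom
  map_zero φ := map_zero φ.toAlgHom
  map_one φ := map_one φ.toAlgHom
  commutes φ := φ.toAlgHom.commutes

instance : SupHomClass (Character A) A ℝ where
  map_sup φ := φ.map_sup'

@[ext]
theorem ext {φ ψ : Character A} (h : ∀ a, φ a = ψ a) : φ = ψ :=
  DFunLike.ext φ ψ h

@[simp]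
theorem apply_algebraMap (φ : Character A) (r : ℝ) : φ (algebraMap ℝ A r) = r :=
  AlgHomClass.commutes φ r

theorem map_real_smul (φ : Character A) (r : ℝ) (a : A) : φ (r • a) = r * φ a := by
  rw [map_smul, smul_eq_mul]

/-- Composition of a character with a lattice and algebra homomorphism. -/
def comp {B : Type u} [CommRing B] [Lattice B] [Algebra ℝ B] (φ : Character B) (f : A →ₐ[ℝ] B)
    (hf : ∀ a b, f (a ⊔ b) = f a ⊔ f b) : Character A where
  toAlgHom := φ.toAlgHom.comp f
  map_sup' a b := (congrArg φ (hf a b)).trans (map_sup φ _ _)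

@[simp]
theorem comp_apply {B : Type u} [CommRing B] [Lattice B] [Algebra ℝ B] (φ : Character B)
    (f : A →ₐ[ℝ] B) (hf : ∀ a b, f (a ⊔ b) = f a ⊔ f b) (a : A) : φ.comp f hf a = φ (f a) :=
  rfl

instance : TopologicalSpace (Character A) :=
  TopologicalSpace.induced (fun φ a => φ a) Pi.topologicalSpace

theorem isInducing_coe : Topology.IsInducing (fun (φ : Character A) (a : A) => φ a) :=
  ⟨rfl⟩

theorem continuous_apply (a : A) : Continuous fun φ : Character A => φ a :=
  (_root_.continuous_apply a).comp isInducing_coe.continuous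

theorem continuous_iff {X : Type*} [TopologicalSpace X] {f : X → Character A} :
    Continuous f ↔ ∀ a, Continuous fun x => f x a := by
  rw [isInducing_coe.continuous_iff, continuous_pi_iff]
  rfl

instance : T2Space (Character A) :=
  T2Space.of_injective_continuous (f := fun (φ : Character A) (a : A) => φ a)
    (fun _ _ h => ext (congrFun h)) isInducing_coe.continuous

protected theorem monotone (φ : Character A) : Monotone φ :=
  OrderHomClass.mono φ

theorem apply_nonneg (φ : Character A) {a : A} (ha : 0 ≤ a) : 0 ≤ φ a := by
  simpa using φ.monotone ha

theorem apply_posPart (φ : Character A) (a : A) : φ a⁺ = (φ a)⁺ := by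
  rw [posPart_def, posPart_def, map_sup, map_zero]

theorem apply_negPart (φ : Character A) (a : A) : φ a⁻ = (φ a)⁻ := by
  rw [negPart_def, negPart_def, map_sup, map_zero, map_neg]

theorem apply_abs (φ : Character A) (a : A) : φ |a| = |φ a| := by
  rw [abs, abs, map_sup, map_neg]

theorem isClosed_range_coe :
    IsClosed (Set.range fun (φ : Character A) (a : A) => φ a) := by
  have : (Set.range fun (φ : Character A) (a : A) => φ a) =
      {f | (∀ r, f (algebraMap ℝ A r) = r) ∧ (∀ a b, f (a + b) = f a + f b) ∧
        (∀ a b, f (a * b) = f a * f b) ∧ ∀ a b, f (a ⊔ b) = f a ⊔ f b} := by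
    ext f
    constructor
    · rintro ⟨φ, rfl⟩
      exact ⟨φ.apply_algebraMap, map_add φ, map_mul φ, map_sup φ⟩
    · rintro ⟨hr, hadd, hmul, hsup⟩
      exact ⟨{  toFun := f
                map_one' := by simpa using hr 1
                map_mul' := hmul
                map_zero' := by simpa using hr 0
                map_add' := hadd
                commutes' := hr
                map_sup' := hsup }, rfl⟩
  rw [this]
  simp only [Set.ofPred_and, Set.ofPred_forall]
  refine .inter (isClosed_iInter fun _ => ?_) (.inter ?_ (.inter ?_ ?_))
  · exact isClosed_eq (by fun_prop) (by fun_prop)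
  all_goals
    exact isClosed_iInter fun _ => isClosed_iInter fun _ => isClosed_eq (by fun_prop) (by fun_prop)

/-- The homomorphism sending `a` to evaluation at `a`. -/
def gelfand : A →ₐ[ℝ] C(Character A, ℝ) where
  toFun a := ⟨fun φ => φ a, continuous_apply a⟩
  map_one' := by ext φ; exact map_one φ
  map_mul' a b := by ext φ; exact map_mul φ a b
  map_zero' := by ext φ; exact map_zero φ
  map_add' a b := by ext φ; exact map_add φ a b
  commutes' r := by ext φ; exact φ.apply_algebraMap r

@[simp]
theorem gelfand_apply (a : A) (φ : Character A) : gelfand a φ = φ a :=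
  rfl

end

variable {A : Type u} [CommRing A] [Lattice A] [Algebra ℝ A] [IsBal A]

instance : InfHomClass (Character A) A ℝ where
  map_inf φ a b := by
    have h : φ (-a ⊔ -b) = φ (-a) ⊔ φ (-b) := map_sup φ (-a) (-b)
    rw [← neg_inf, map_neg, map_neg, map_neg, ← neg_inf] at h
    exact neg_injective h

/-- Tychonoff: boundedness of each `a` confines its values to a fixed interval, and the homomorphism
equations are closed conditions. -/
instance : CompactSpace (Character A) := by
  choose r _ hr using exists_abs_le_algebraMap (A := A)
  have hK : IsCompact (Set.univ.pi fun a : A => Set.Icc (-r a) (r a)) :=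
    isCompact_univ_pi fun _ => isCompact_Icc
  have hsub : (Set.range fun (φ : Character A) (a : A) => φ a) ⊆
      Set.univ.pi fun a : A => Set.Icc (-r a) (r a) := by
    rintro _ ⟨φ, rfl⟩ a -
    have h := φ.monotone (hr a)
    rw [φ.apply_abs, apply_algebraMap] at h
    exact abs_le.1 h
  rw [← isCompact_univ_iff, isInducing_coe.isCompact_iff, Set.image_univ]
  exact hK.of_isClosed_subset isClosed_range_coe hsub

/-! ### Characters and maximal `ℓ`-ideals -/

/-- The kernel of a character, a maximal `ℓ`-ideal. -/
def ker (φ : Character A) : MaxLIdeal A :=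
  ⟨RingHom.ker φ, by
    refine ⟨⟨fun a b hab hb => ?_, RingHom.ker_ne_top _⟩, fun J hJ hle b hb => ?_⟩
    · have h := φ.monotone hab
      rw [RingHom.mem_ker] at hb ⊢
      rw [φ.apply_abs, φ.apply_abs, hb, abs_zero] at h
      exact abs_nonpos_iff.1 h
    · by_contra hne
      have h1 : b - algebraMap ℝ A (φ b) ∈ J := hle (by simp [RingHom.mem_ker])
      exact algebraMap_notMem hJ.2 hne ((J.sub_mem_iff_right hb).1 h1)⟩

omit [IsBal A] in
theorem mem_ker {φ : Character A} {a : A} : a ∈ φ.ker.1 ↔ φ a = 0 :=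
  RingHom.mem_ker

omit [IsBal A] in
theorem sub_algebraMap_mem_ker (φ : Character A) (a : A) :
    a - algebraMap ℝ A (φ a) ∈ φ.ker.1 :=
  mem_ker.2 (by simp)

/-- The constant congruent to `a` modulo `M` is unique because `M` is proper. Each homomorphism law
therefore reduces to a congruence modulo `M`. -/
theorem exists_forall_apply_eq_zero_iff {M : Ideal A}
    (hM : Maximal (fun J : Ideal A => IsLIdeal J ∧ J ≠ ⊤) M) :
    ∃ φ : Character A, ∀ a, φ a = 0 ↔ a ∈ M := by
  choose f hf using exists_sub_algebraMap_mem hM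
  have huniq : ∀ {a : A} {r : ℝ}, a - algebraMap ℝ A r ∈ M → f a = r := by
    intro a r h
    by_contra hne
    refine algebraMap_notMem (A := A) hM.prop.2 (sub_ne_zero.2 hne) ?_
    simpa using M.sub_mem h (hf a)
  have hconst : ∀ r, f (algebraMap ℝ A r) = r := fun r => huniq (by simp)
  refine ⟨{ toFun := f
            map_one' := by simpa using hconst 1
            map_zero' := by simpa using hconst 0
            map_mul' := fun a b => huniq ?_
            map_add' := fun a b => huniq ?_
            commutes' := hconst
            map_sup' := fun a b => huniq ?_ }, fun a => ?_⟩
  · convert M.add_mem (M.mul_mem_right b (hf a)) (M.mul_mem_left (algebraMap ℝ A (f a)) (hf b))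
      using 1
    rw [map_mul]
    ring
  · convert M.add_mem (hf a) (hf b) using 1
    rw [map_add]
    ring
  -- Joins respect the congruence since `|a ⊔ b - c ⊔ d| ≤ |a - c| + |b - d|`.
  · refine hM.prop.1.mem_of_abs_le (b := |a - algebraMap ℝ A (f a)| + |b - algebraMap ℝ A (f b)|)
      ?_ (M.add_mem (hM.prop.1.abs_mem_iff.2 (hf a)) (hM.prop.1.abs_mem_iff.2 (hf b)))
    rw [algebraMap_sup]
    calc |a ⊔ b - algebraMap ℝ A (f a) ⊔ algebraMap ℝ A (f b)|
        = |(a ⊔ b - algebraMap ℝ A (f a) ⊔ b) +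
            (b ⊔ algebraMap ℝ A (f a) - algebraMap ℝ A (f b) ⊔ algebraMap ℝ A (f a))| := by
          rw [sup_comm b, sup_comm (algebraMap ℝ A (f b)), sub_add_sub_cancel]
      _ ≤ _ := (abs_add_le _ _).trans
          (add_le_add (abs_sup_sub_sup_le_abs _ _ _) (abs_sup_sub_sup_le_abs _ _ _))
  · change f a = 0 ↔ a ∈ M
    refine ⟨fun h => by simpa [h] using hf a, fun h => huniq (by simpa using h)⟩

/-- Characters correspond to maximal `ℓ`-ideals. -/
noncomputable def equivMaxLIdeal : Character A ≃ MaxLIdeal A :=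
  Equiv.ofBijective ker <| by
    constructor
    · intro φ ψ h
      ext a
      have h1 := φ.sub_algebraMap_mem_ker a
      rw [h, mem_ker, map_sub, apply_algebraMap, sub_eq_zero] at h1
      exact h1.symm
    · rintro ⟨M, hM⟩
      obtain ⟨φ, hφ⟩ := exists_forall_apply_eq_zero_iff hM
      exact ⟨φ, Subtype.ext (Ideal.ext fun a => mem_ker.trans (hφ a))⟩

/-! ### Existence of characters -/

/-- The source of all characters with prescribed zeros: the ℓ-ideal generated by `P` is proper
exactly when no element of `P` dominates `1`. -/
theorem exists_forall_apply_eq_zero (P : AddSubmonoid A) (h0 : ∀ p ∈ P, 0 ≤ p)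
    (h1 : ∀ p ∈ P, ¬ 1 ≤ p) : ∃ φ : Character A, ∀ p ∈ P, φ p = 0 := by
  have hne : coneIdeal P ≠ ⊤ := by
    rw [Ne, Ideal.eq_top_iff_one]
    rintro ⟨p, hp, hle⟩
    exact h1 p hp ((le_abs_self 1).trans hle)
  obtain ⟨M, hPM, hM⟩ := exists_le_maximal_lideal (isLIdeal_coneIdeal P) hne
  obtain ⟨φ, hφ⟩ := exists_forall_apply_eq_zero_iff hM
  exact ⟨φ, fun p hp => (hφ p).2 (hPM (mem_coneIdeal_of_nonneg (h0 p hp) hp))⟩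

/-- A character killing `a⁻` is wanted. If some `n • a⁻` dominated `1`, then `a⁺` would lie below a
multiple of `a⁻`, and disjointness of the two parts would force `a⁺ = 0`. -/
theorem exists_apply_nonneg {a : A} (ha : ¬ a ≤ 0) : ∃ φ : Character A, 0 ≤ φ a := by
  obtain ⟨φ, hφ⟩ := exists_forall_apply_eq_zero (AddSubmonoid.multiples a⁻)
    (by
      rintro _ ⟨n, rfl⟩
      exact nsmul_nonneg (negPart_nonneg a) n)
    (by
      rintro _ ⟨n, rfl⟩ h1
      apply ha
      obtain ⟨k, hk⟩ := IsBal.bounded a⁺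
      have h2 : a⁺ ≤ (k * n + 1) • a⁻ := calc
        a⁺ ≤ k • (1 : A) := hk
        _ ≤ k • (n • a⁻) := nsmul_le_nsmul_right h1 k
        _ = (k * n) • a⁻ := (mul_smul k n _).symm
        _ ≤ (k * n + 1) • a⁻ := nsmul_le_nsmul_left (negPart_nonneg a) (by lia)
      have h3 : a⁺ ≤ (k * n + 1) • a⁺ :=
        (one_nsmul a⁺).symm.le.trans (nsmul_le_nsmul_left (posPart_nonneg a) (by lia))
      have h4 := le_inf h3 h2
      rw [← succ_nsmul_inf, posPart_inf_negPart_eq_zero, smul_zero] at h4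
      exact posPart_nonpos.1 h4)
  refine ⟨φ, ?_⟩
  have := hφ a⁻ (AddSubmonoid.mem_multiples _)
  rwa [apply_negPart, negPart_eq_zero] at this

/-- The archimedean axiom enters here: if `n • a ≤ 1` failed, some character would satisfy `n * φ a
≥ 1`. -/
theorem nonpos_of_forall_apply_nonpos {a : A} (h : ∀ φ : Character A, φ a ≤ 0) : a ≤ 0 := by
  refine IsBal.archimedean a 1 fun n => ?_
  by_contra hn
  obtain ⟨φ, hφ⟩ := exists_apply_nonneg (a := n • a - 1) (by rwa [sub_nonpos])
  have h1 : 0 ≤ (n : ℝ) * φ a - 1 := by simpa using hφ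
  nlinarith [h φ, (Nat.cast_nonneg n : (0 : ℝ) ≤ n)]

theorem le_of_forall_apply_le {a b : A} (h : ∀ φ : Character A, φ a ≤ φ b) : a ≤ b :=
  sub_nonpos.1 (nonpos_of_forall_apply_nonpos fun φ => by simpa using h φ)

theorem eq_of_forall_apply_eq {a b : A} (h : ∀ φ : Character A, φ a = φ b) : a = b :=
  le_antisymm (le_of_forall_apply_le fun φ => (h φ).le) (le_of_forall_apply_le fun φ => (h φ).ge)

/-! ### The Gelfand transform -/

omit [IsBal A] in
theorem gelfand_sup (a b : A) : gelfand (a ⊔ b) = gelfand a ⊔ gelfand b :=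
  ContinuousMap.ext fun φ => map_sup φ a b

theorem gelfand_inf (a b : A) : gelfand (a ⊓ b) = gelfand a ⊓ gelfand b :=
  ContinuousMap.ext fun φ => map_inf φ a b

theorem gelfand_injective : Function.Injective (gelfand (A := A)) :=
  fun _ _ h => eq_of_forall_apply_eq fun φ => DFunLike.congr_fun h φ

theorem exists_norm_gelfand_sub_lt (f : C(Character A, ℝ)) {ε : ℝ} (hε : 0 < ε) :
    ∃ a : A, ‖gelfand a - f‖ < ε := by
  obtain ⟨⟨_, a, rfl⟩, ha⟩ :=
    ContinuousMap.exists_mem_subalgebra_near_continuousMap_of_separatesPoints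
    (gelfand (A := A)).range (by
      intro φ ψ hne
      obtain ⟨a, ha⟩ := DFunLike.ne_iff.1 hne
      exact ⟨_, ⟨gelfand a, ⟨a, rfl⟩, rfl⟩, ha⟩) f ε hε
  exact ⟨a, ha⟩

/-- Points are separated from closed sets by elements of the algebra. -/
theorem exists_separating {S : Set (Character A)} (hS : IsClosed S) {φ : Character A}
    (hφ : φ ∉ S) : ∃ a : A, 0 ≤ a ∧ 0 < φ a ∧ ∀ ψ ∈ S, ψ a = 0 := by
  obtain ⟨f, hf0, hf1, -⟩ := exists_continuous_zero_one_of_isClosed hS isClosed_singleton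
    (Set.disjoint_singleton_right.2 hφ)
  obtain ⟨a, ha⟩ := exists_norm_gelfand_sub_lt f (ε := 1 / 2) (by norm_num)
  have hdist : ∀ ψ : Character A, |ψ a - f ψ| < 1 / 2 := fun ψ =>
    ((gelfand a - f).norm_coe_le_norm ψ).trans_lt ha
  -- An approximation of a Urysohn function with error below `1 / 2`, cut off at height `1 / 2`,
  -- vanishes exactly on `S` and stays positive at `φ`.
  refine ⟨(a - algebraMap ℝ A (1 / 2))⁺, posPart_nonneg _, ?_, fun ψ hψ => ?_⟩
  · have h1 := abs_lt.1 (hdist φ)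
    rw [hf1 rfl, Pi.one_apply] at h1
    rw [apply_posPart, posPart_pos_iff, map_sub, apply_algebraMap]
    linarith
  · have h1 := abs_lt.1 (hdist ψ)
    rw [hf0 hψ, Pi.zero_apply] at h1
    rw [apply_posPart, posPart_eq_zero, map_sub, apply_algebraMap]
    linarith

/-- The hull-kernel topology agrees with pointwise convergence: a closed `S` is the hull of the
intersection of its kernels, by separation. -/
theorem isClosed_iff_exists_lideal {S : Set (Character A)} :
    IsClosed S ↔ ∃ I : Ideal A, IsLIdeal I ∧ S = {φ | I ≤ φ.ker.1} := by
  constructor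
  · intro hS
    refine ⟨⨅ φ ∈ S, φ.ker.1, ?_, ?_⟩
    · intro a b hab hb
      simp only [Submodule.mem_iInf] at hb ⊢
      exact fun φ hφ => φ.ker.2.prop.1 a b hab (hb φ hφ)
    · refine subset_antisymm (fun φ hφ => ?_) fun φ hφ => ?_
      · exact iInf₂_le (f := fun (ψ : Character A) (_ : ψ ∈ S) => ψ.ker.1) φ hφ
      by_contra hφS
      obtain ⟨a, -, ha, haS⟩ := exists_separating hS hφS
      exact ha.ne' (mem_ker.1 (hφ (by
        simp only [Submodule.mem_iInf]
        exact fun ψ hψ => mem_ker.2 (haS ψ hψ))))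
  · rintro ⟨I, -, rfl⟩
    have : {φ : Character A | I ≤ φ.ker.1} = ⋂ a ∈ I, {φ | φ a = 0} := by
      ext φ
      simp [SetLike.le_def, mem_ker]
    rw [this]
    exact isClosed_biInter fun a _ => isClosed_eq (continuous_apply a) continuous_const

end Character

/-! ### Modal operators and relations on characters -/

section Modal

variable {A : Type u} [CommRing A] [Lattice A] [Algebra ℝ A] {box : A → A}

namespace IsModalOperator

variable (hbox : IsModalOperator box)

include hbox

theorem monotone : Monotone box := fun a b h => by
  rw [← inf_eq_left] at h ⊢
  rw [← hbox.map_inf, h]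

variable (h0 : box 0 = 0)

include h0

theorem box_algebraMap (r : ℝ) : box (algebraMap ℝ A r) = algebraMap ℝ A r := by
  rw [hbox.map_real, h0, mul_zero, add_zero]

theorem box_add_algebraMap (a : A) (r : ℝ) :
    box (a + algebraMap ℝ A r) = box a + algebraMap ℝ A r := by
  rw [hbox.map_add_real, h0, sub_zero, hbox.box_algebraMap h0]

theorem box_smul {r : ℝ} (hr : 0 ≤ r) (a : A) : box (r • a) = r • box a := by
  rw [hbox.map_smul r a hr, hbox.box_algebraMap h0, Algebra.smul_def]

theorem box_nonneg {a : A} (ha : 0 ≤ a) : 0 ≤ box a :=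
  h0.symm.le.trans (hbox.monotone ha)

end IsModalOperator

/-- The relation `R_□` on characters. -/
def modalRel (box : A → A) (φ ψ : Character A) : Prop :=
  ∀ a, φ (box a) ≤ ψ a

variable [IsBal A]

section

variable (hbox : IsModalOperator box) (h0 : box 0 = 0)

include hbox h0

omit [IsBal A] in
-- The ideal condition is tested on `(a - ψ a)⁺`, which `ψ` kills; `□` commutes with positive parts
-- and real translations.
theorem modalRel_iff {φ ψ : Character A} :
    modalRel box φ ψ ↔ ∀ a, 0 ≤ a → a ∈ ψ.ker.1 → box a ∈ φ.ker.1 := by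
  simp only [Character.mem_ker]
  constructor
  · intro h a ha hψ
    exact le_antisymm ((h a).trans hψ.le) (φ.apply_nonneg (hbox.box_nonneg h0 ha))
  · intro h a
    have h1 := h (a - algebraMap ℝ A (ψ a))⁺ (posPart_nonneg _)
      (by rw [Character.apply_posPart]; simp)
    rw [posPart_def, hbox.map_pos, ← posPart_def, Character.apply_posPart, posPart_eq_zero,
      sub_eq_add_neg, ← map_neg, hbox.box_add_algebraMap h0, map_add,
      Character.apply_algebraMap] at h1
    linarith

/-- A character is a successor of `φ` as soon as it kills the cone `T` of those `t ≥ 0` with `φ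
(□(-t)) ≥ 0`, because `(a - φ (□a))⁻ ∈ T` for every `a`. So it suffices that no element of `S + T`
dominates `1`. -/
theorem exists_modalRel_forall_apply_eq_zero (φ : Character A) (S : AddSubmonoid A)
    (hS : ∀ s ∈ S, 0 ≤ s) (hφ : ∀ s ∈ S, φ (box s) ≤ 0) :
    ∃ ψ, modalRel box φ ψ ∧ ∀ s ∈ S, ψ s = 0 := by
  let T : AddSubmonoid A :=
    { carrier := {t | 0 ≤ t ∧ 0 ≤ φ (box (-t))}
      zero_mem' := ⟨le_rfl, by simp [h0]⟩
      add_mem' := by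
        rintro s t ⟨hs, hs'⟩ ⟨ht, ht'⟩
        refine ⟨add_nonneg hs ht, ?_⟩
        -- `□` is not additive, but it preserves meets and positive scaling, so the sum is bounded
        -- by a doubled meet.
        have h1 : (2 : ℝ) • (-s ⊓ -t) ≤ -(s + t) := by
          rw [two_smul, neg_add]
          exact add_le_add inf_le_left inf_le_right
        refine le_trans ?_ (φ.monotone (hbox.monotone h1))
        rw [hbox.box_smul h0 (by norm_num), hbox.map_inf, Character.map_real_smul, map_inf]
        exact mul_nonneg (by norm_num) (le_inf hs' ht') }
  obtain ⟨ψ, hψ⟩ := Character.exists_forall_apply_eq_zero (S ⊔ T)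
    (by
      intro p hp
      obtain ⟨s, hs, t, ht, rfl⟩ := AddSubmonoid.mem_sup.1 hp
      exact add_nonneg (hS s hs) ht.1)
    (by
      intro p hp h1
      obtain ⟨s, hs, t, ht, rfl⟩ := AddSubmonoid.mem_sup.1 hp
      -- Applying `φ ∘ □` gives `φ (□(-t)) + 1 ≤ φ (□s) ≤ 0`, against `t ∈ T`.
      have h2 : -t + algebraMap ℝ A 1 ≤ s := by
        rw [map_one, neg_add_eq_sub]
        exact sub_le_iff_le_add.2 h1
      have h3 := φ.monotone (hbox.monotone h2)
      rw [hbox.box_add_algebraMap h0, map_add, Character.apply_algebraMap] at h3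
      linarith [hφ s hs, ht.2])
  refine ⟨ψ, fun a => ?_, fun s hs => hψ s (AddSubmonoid.mem_sup_left hs)⟩
  set b := a - algebraMap ℝ A (φ (box a)) with hb
  have hφb : φ (box b) = 0 := by
    rw [hb, sub_eq_add_neg, ← map_neg, hbox.box_add_algebraMap h0, map_add,
      Character.apply_algebraMap, add_neg_cancel]
  have hbT : b⁻ ∈ T := by
    refine ⟨negPart_nonneg b, ?_⟩
    rw [negPart_eq_neg_inf_zero, neg_neg, hbox.map_inf, h0, map_inf, hφb, map_zero, inf_idem]
  have h1 := hψ _ (AddSubmonoid.mem_sup_right hbT)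
  rw [Character.apply_negPart, negPart_eq_zero, hb, map_sub, Character.apply_algebraMap] at h1
  linarith

/-- With `b = a - φ (□a)`, the map `φ ∘ □` vanishes on the multiples of `b⁺`; a successor killing
`b⁺` attains the bound. -/
theorem isLeast_apply_box (φ : Character A) (a : A) :
    IsLeast ((fun ψ : Character A => ψ a) '' {ψ | modalRel box φ ψ}) (φ (box a)) := by
  refine ⟨?_, by rintro _ ⟨ψ, hψ, rfl⟩; exact hψ a⟩
  set b := a + algebraMap ℝ A (-φ (box a)) with hb
  have hφb : φ (box b⁺) = 0 := by
    rw [posPart_def, hbox.map_pos, ← posPart_def, Character.apply_posPart, hb,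
      hbox.box_add_algebraMap h0, map_add, Character.apply_algebraMap, add_neg_cancel,
      posPart_zero]
  obtain ⟨ψ, hψ, hψb⟩ := exists_modalRel_forall_apply_eq_zero hbox h0 φ
    (AddSubmonoid.multiples b⁺)
    (by rintro _ ⟨n, rfl⟩; exact nsmul_nonneg (posPart_nonneg b) n)
    (by
      rintro _ ⟨n, rfl⟩
      change φ (box (n • b⁺)) ≤ 0
      rw [← Nat.cast_smul_eq_nsmul ℝ, hbox.box_smul h0 n.cast_nonneg, Character.map_real_smul,
        hφb, mul_zero])
  refine ⟨ψ, hψ, le_antisymm ?_ (hψ a)⟩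
  have h1 := hψb _ (AddSubmonoid.mem_multiples _)
  rw [Character.apply_posPart, posPart_eq_zero, hb, map_add, Character.apply_algebraMap] at h1
  simpa using h1

theorem modalRel_serial (φ : Character A) : ∃ ψ, modalRel box φ ψ := by
  obtain ⟨ψ, hψ, -⟩ := (isLeast_apply_box hbox h0 φ 0).1
  exact ⟨ψ, hψ⟩

end

/-! ### Continuity and functoriality of `R_□` -/

omit [IsBal A] in
theorem isClosed_modalRel (box : A → A) :
    IsClosed {p : Character A × Character A | modalRel box p.1 p.2} := by
  simp only [modalRel, Set.ofPred_forall]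
  exact isClosed_iInter fun a => isClosed_le
    ((Character.continuous_apply _).comp continuous_fst)
    ((Character.continuous_apply _).comp continuous_snd)

theorem isContinuousRel_modalRel (hbox : IsModalOperator box) (h0 : box 0 = 0) :
    IsContinuousRel (modalRel box) where
  isClosed_image φ := (isClosed_modalRel box).preimage (Continuous.prodMk_right φ)
  isClosed_preimage F hF := by
    have h1 := ((isClosed_modalRel box).inter
      (hF.preimage (continuous_snd (X := Character A)))).isCompact.image continuous_fst
    convert h1.isClosed using 1
    ext φ
    constructor
    · rintro ⟨ψ, hψ, h⟩
      exact ⟨(φ, ψ), ⟨h, hψ⟩, rfl⟩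
    · rintro ⟨⟨_, ψ⟩, ⟨h, hψ⟩, rfl⟩
      exact ⟨ψ, hψ, h⟩
  isOpen_preimage U hU := by
    rw [isOpen_iff_forall_mem_open]
    rintro φ ⟨ψ, hψ, h⟩
    obtain ⟨a, -, ha, haU⟩ := Character.exists_separating hU.isClosed_compl (φ := ψ)
      (fun hn => hn hψ)
    -- Since `χ (□(-a))` is an attained minimum, its negativity yields a successor where `a ≠ 0`,
    -- hence one in `U`.
    refine ⟨{χ | χ (box (-a)) < 0}, fun χ hχ => ?_,
      isOpen_lt (Character.continuous_apply _) continuous_const, ?_⟩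
    · obtain ⟨ξ, hξ, he⟩ := (isLeast_apply_box hbox h0 χ (-a)).1
      refine ⟨ξ, ?_, hξ⟩
      by_contra hn
      rw [Set.mem_ofPred_eq, ← he] at hχ
      simp [haU ξ hn] at hχ
    · have h1 := h (-a)
      rw [map_neg] at h1
      exact h1.trans_lt (neg_neg_iff_pos.2 ha)

/-- Precomposition with a homomorphism of modal algebras is a bounded morphism. -/
theorem image_comp_modalRel {B : Type u} [CommRing B] [Lattice B] [Algebra ℝ B] [IsBal B]
    {boxB : B → B} (hbox : IsModalOperator boxB) (h0 : boxB 0 = 0) (f : A →ₐ[ℝ] B)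
    (hf : ∀ a b, f (a ⊔ b) = f a ⊔ f b) (hfbox : ∀ a, f (box a) = boxB (f a))
    (φ : Character B) :
    (fun ψ : Character B => ψ.comp f hf) '' {ψ | modalRel boxB φ ψ} =
      {ψ | modalRel box (φ.comp f hf) ψ} := by
  ext χ
  constructor
  · rintro ⟨ψ, hψ, rfl⟩ a
    simpa [hfbox] using hψ (f a)
  · intro hχ
    have hmono : ∀ {a : A}, 0 ≤ a → 0 ≤ f a := fun {a} ha => by
      have h1 := hf a 0
      rw [sup_eq_left.2 ha, map_zero] at h1
      exact sup_eq_left.1 h1.symm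
    -- The image of the positive part of `ker χ`. A successor killing it kills every `f |a - χ a|`,
    -- so it restricts to `χ` along `f`.
    let S : AddSubmonoid B :=
      { carrier := {b | ∃ c : A, 0 ≤ c ∧ χ c = 0 ∧ f c = b}
        zero_mem' := ⟨0, le_rfl, map_zero χ, map_zero f⟩
        add_mem' := by
          rintro _ _ ⟨c, hc, hc', rfl⟩ ⟨d, hd, hd', rfl⟩
          exact ⟨c + d, add_nonneg hc hd, by rw [map_add, hc', hd', add_zero], map_add f c d⟩ }
    obtain ⟨ψ, hψ, hψS⟩ := exists_modalRel_forall_apply_eq_zero hbox h0 φ S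
      (by
        rintro _ ⟨c, hc, -, rfl⟩
        exact hmono hc)
      (by
        rintro _ ⟨c, hc, hc', rfl⟩
        rw [← hfbox]
        exact (hχ c).trans hc'.le)
    refine ⟨ψ, hψ, Character.ext fun a => ?_⟩
    have h1 := hψS _ ⟨|a - algebraMap ℝ A (χ a)|, abs_nonneg _, by
      rw [Character.apply_abs]; simp, rfl⟩
    change ψ.comp f hf _ = 0 at h1
    rw [Character.apply_abs, abs_eq_zero, map_sub, Character.apply_algebraMap, sub_eq_zero] at h1
    exact h1

end Modal

/-! ### The operator `□_R` on continuous functions -/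

section Functions

variable {X : Type u} [TopologicalSpace X] [CompactSpace X]

instance : IsBal C(X, ℝ) where
  add_le_add _ _ c h := add_le_add_left h c
  mul_nonneg _ _ ha hb := mul_nonneg ha hb
  smul_nonneg r a hr ha x := by
    have := ha x
    exact mul_nonneg hr this
  bounded a := by
    obtain ⟨n, hn⟩ := exists_nat_ge ‖a‖
    refine ⟨n, fun x => ?_⟩
    have h1 := (le_abs_self _).trans ((a.norm_coe_le_norm x).trans hn)
    simpa using h1
  archimedean a b h x := by
    by_contra hx
    change ¬ a x ≤ 0 at hx
    obtain ⟨n, hn⟩ := exists_lt_nsmul (not_le.1 hx) (b x)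
    exact absurd (h n x) (by simpa using hn)

variable {R : X → X → Prop}

section

variable (hR : IsContinuousRel R) (hser : ∀ x, ∃ y, R x y)

include hR hser

theorem isLeast_sInf_image (f : C(X, ℝ)) (x : X) :
    IsLeast (f '' {y | R x y}) (sInf (f '' {y | R x y})) :=
  ((hR.isClosed_image x).isCompact.image f.continuous).isLeast_sInf (Set.Nonempty.image f (hser x))

/-- As the infimum is attained, its sublevel sets are preimages under `R`: closed ones give lower
and open ones upper semicontinuity. -/
theorem continuous_sInf_image (f : C(X, ℝ)) : Continuous fun x => sInf (f '' {y | R x y}) := by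
  rw [continuous_iff_lower_upperSemicontinuous, lowerSemicontinuous_iff_isClosed_preimage,
    upperSemicontinuous_iff_isOpen_preimage]
  have hleast := isLeast_sInf_image hR hser f
  refine ⟨fun c => ?_, fun c => ?_⟩
  · convert hR.isClosed_preimage _ (isClosed_le f.continuous (continuous_const (y := c))) using 1
    ext x
    constructor
    · intro h
      obtain ⟨y, hy, he⟩ := (hleast x).1
      exact ⟨y, he.le.trans h, hy⟩
    · rintro ⟨y, hy, hxy⟩
      exact ((hleast x).2 ⟨y, hxy, rfl⟩).trans hy
  · convert hR.isOpen_preimage _ (isOpen_lt f.continuous (continuous_const (y := c))) using 1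
    ext x
    constructor
    · intro h
      obtain ⟨y, hy, he⟩ := (hleast x).1
      exact ⟨y, he.le.trans_lt h, hy⟩
    · rintro ⟨y, hy, hxy⟩
      exact ((hleast x).2 ⟨y, hxy, rfl⟩).trans_lt hy

end

/-- The operator `□_R` on `C(X)`. -/
noncomputable def boxRel (hR : IsContinuousRel R) (hser : ∀ x, ∃ y, R x y) (f : C(X, ℝ)) :
    C(X, ℝ) :=
  ⟨fun x => sInf (f '' {y | R x y}), continuous_sInf_image hR hser f⟩

variable (hR : IsContinuousRel R) (hser : ∀ x, ∃ y, R x y)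

theorem isLeast_boxRel (f : C(X, ℝ)) (x : X) :
    IsLeast (f '' {y | R x y}) (boxRel hR hser f x) :=
  isLeast_sInf_image hR hser f x

theorem boxRel_apply_le (f : C(X, ℝ)) {x y : X} (h : R x y) : boxRel hR hser f x ≤ f y :=
  (isLeast_boxRel hR hser f x).2 ⟨y, h, rfl⟩

theorem exists_boxRel_apply_eq (f : C(X, ℝ)) (x : X) : ∃ y, R x y ∧ boxRel hR hser f x = f y := by
  obtain ⟨y, hy, he⟩ := (isLeast_boxRel hR hser f x).1
  exact ⟨y, hy, he.symm⟩

/-- Monotone maps commute with attained minima; every modal axiom except the one for meets follows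
from this. -/
theorem boxRel_apply_comp (f : C(X, ℝ)) {g : ℝ → ℝ} (hg : Monotone g) {F : C(X, ℝ)}
    (hF : ∀ y, F y = g (f y)) (x : X) : boxRel hR hser F x = g (boxRel hR hser f x) := by
  refine le_antisymm ?_ ?_
  · obtain ⟨y, hy, he⟩ := exists_boxRel_apply_eq hR hser f x
    rw [he, ← hF]
    exact boxRel_apply_le hR hser F hy
  · obtain ⟨y, hy, he⟩ := exists_boxRel_apply_eq hR hser F x
    rw [he, hF]
    exact hg (boxRel_apply_le hR hser f hy)

theorem boxRel_algebraMap (r : ℝ) :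
    boxRel hR hser (algebraMap ℝ C(X, ℝ) r) = algebraMap ℝ C(X, ℝ) r := by
  ext x
  exact boxRel_apply_comp hR hser 0 (g := fun _ => r) monotone_const (fun _ => rfl) x

theorem boxRel_zero : boxRel hR hser 0 = 0 := by
  simpa using boxRel_algebraMap hR hser 0

theorem isModalOperator_boxRel : IsModalOperator (boxRel hR hser) where
  map_inf f g := by
    ext x
    refine le_antisymm (le_inf ?_ ?_) ?_
    · obtain ⟨y, hy, he⟩ := exists_boxRel_apply_eq hR hser f x
      rw [he]
      exact (boxRel_apply_le hR hser (f ⊓ g) hy).trans inf_le_left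
    · obtain ⟨y, hy, he⟩ := exists_boxRel_apply_eq hR hser g x
      rw [he]
      exact (boxRel_apply_le hR hser (f ⊓ g) hy).trans inf_le_right
    · obtain ⟨y, hy, he⟩ := exists_boxRel_apply_eq hR hser (f ⊓ g) x
      rw [he]
      exact inf_le_inf (boxRel_apply_le hR hser f hy) (boxRel_apply_le hR hser g hy)
  map_real r := by rw [boxRel_algebraMap, boxRel_zero, mul_zero, add_zero]
  map_pos f := by
    ext x
    exact boxRel_apply_comp hR hser f (g := fun t => t ⊔ 0)
      (fun _ _ h => sup_le_sup_right h 0) (fun _ => rfl) x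
  map_add_real f r := by
    rw [boxRel_algebraMap, boxRel_zero, sub_zero]
    ext x
    exact boxRel_apply_comp hR hser f (g := fun t => t + r)
      (fun _ _ h => add_le_add_left h r) (fun _ => rfl) x
  map_smul r f hr := by
    rw [boxRel_algebraMap]
    ext x
    exact boxRel_apply_comp hR hser f (g := fun t => r * t)
      (fun _ _ h => mul_le_mul_of_nonneg_left h hr) (fun _ => rfl) x

theorem boxRel_comp {X' : Type u} [TopologicalSpace X'] [CompactSpace X'] {R' : X' → X' → Prop}
    (hR' : IsContinuousRel R') (hser' : ∀ x, ∃ y, R' x y) (φ : C(X, X'))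
    (hφ : ∀ x, φ '' {y | R x y} = {y | R' (φ x) y}) (f : C(X', ℝ)) :
    (boxRel hR' hser' f).comp φ = boxRel hR hser (f.comp φ) := by
  ext x
  change sInf (f '' _) = sInf ((f ∘ φ) '' _)
  rw [← hφ, Set.image_comp]

/-! ### Characters of `C(X)` -/

/-- Evaluation at a point. -/
def evalCharacter (x : X) : Character C(X, ℝ) where
  toAlgHom := ContinuousMap.evalAlgHom ℝ ℝ x
  map_sup' _ _ := rfl

omit [CompactSpace X] in
@[simp]
theorem evalCharacter_apply (x : X) (f : C(X, ℝ)) : evalCharacter x f = f x :=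
  rfl

omit [CompactSpace X] in
theorem continuous_evalCharacter : Continuous (evalCharacter (X := X)) :=
  Character.continuous_iff.2 fun f => f.continuous

/-- The evaluations form a compact, hence closed, set. A character outside it would be nonzero on a
function vanishing at every point. -/
theorem evalCharacter_surjective : Function.Surjective (evalCharacter (X := X)) := by
  intro φ
  by_contra hφ
  obtain ⟨f, -, hf, h0⟩ := Character.exists_separating
    (isCompact_range (continuous_evalCharacter (X := X))).isClosed hφ
  have : f = 0 := by
    ext x
    exact h0 _ ⟨x, rfl⟩
  simp [this] at hf

variable [T2Space X]

omit [CompactSpace X] [T2Space X] in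
theorem exists_continuousMap_zero_one [NormalSpace X] [T1Space X] {F : Set X} (hF : IsClosed F)
    {x : X} (hx : x ∉ F) : ∃ f : C(X, ℝ), f x = 0 ∧ ∀ y ∈ F, f y = 1 := by
  obtain ⟨f, hf0, hf1, -⟩ := exists_continuous_zero_one_of_isClosed isClosed_singleton hF
    (Set.disjoint_singleton_left.2 hx)
  exact ⟨f, hf0 rfl, fun y hy => hf1 hy⟩

theorem evalCharacter_injective : Function.Injective (evalCharacter (X := X)) := by
  intro x y hxy
  by_contra hne
  obtain ⟨f, hfx, hfy⟩ := exists_continuousMap_zero_one (F := {y}) isClosed_singleton hne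
  have h := DFunLike.congr_fun hxy f
  rw [evalCharacter_apply, evalCharacter_apply, hfx, hfy y rfl] at h
  exact zero_ne_one h

/-- If `y ∉ R[x]`, a Urysohn function equal to `0` at `y` and `1` on the closed set `R[x]` violates
the inequality. -/
theorem modalRel_evalCharacter_iff (x y : X) :
    modalRel (boxRel hR hser) (evalCharacter x) (evalCharacter y) ↔ R x y := by
  refine ⟨fun h => ?_, fun h f => boxRel_apply_le hR hser f h⟩
  by_contra hxy
  obtain ⟨f, hfy, hf⟩ := exists_continuousMap_zero_one (hR.isClosed_image x) hxy
  obtain ⟨z, hz, he⟩ := exists_boxRel_apply_eq hR hser f x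
  have h1 := h f
  rw [evalCharacter_apply, evalCharacter_apply, he, hf z hz, hfy] at h1
  exact zero_lt_one.not_ge h1

/-! ### Uniform completeness -/

omit [T2Space X] in
theorem unifNorm_eq_norm (f : C(X, ℝ)) : unifNorm f = ‖f‖ := by
  have h1 : ∀ r : ℝ, |f| ≤ r • (1 : C(X, ℝ)) ↔ ∀ x, ‖f x‖ ≤ r := fun r => by
    simp [ContinuousMap.le_def]
  rw [unifNorm]
  simp only [h1]
  rcases isEmpty_or_nonempty X with hX | hX
  -- On the empty space every real is an upper bound, and `sInf` of all of `ℝ` is `0` by convention.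
  · have : f = 0 := Subsingleton.elim _ _
    simp [this]
  · simp only [← ContinuousMap.norm_le_of_nonempty]
    exact csInf_Ici

omit [T2Space X] in
theorem isUniformlyComplete_continuousMap : IsUniformlyComplete C(X, ℝ) := by
  intro s hs
  simp only [unifNorm_eq_norm, ← dist_eq_norm] at hs ⊢
  have hc : CauchySeq s := Metric.cauchySeq_iff.2 fun ε hε => by
    obtain ⟨N, hN⟩ := hs ε hε
    exact ⟨N, fun m hm n hn => hN m n hm hn⟩
  obtain ⟨a, ha⟩ := cauchySeq_tendsto_of_complete hc
  exact ⟨a, fun ε hε => Metric.tendsto_atTop.1 ha ε hε⟩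

theorem unifNorm_eq_norm_gelfand {A : Type u} [CommRing A] [Lattice A] [Algebra ℝ A] [IsBal A]
    (a : A) : unifNorm a = ‖Character.gelfand a‖ := by
  rw [← unifNorm_eq_norm, unifNorm, unifNorm]
  congr 1
  ext r
  rw [Set.mem_ofPred_eq, Set.mem_ofPred_eq, ← Algebra.algebraMap_eq_smul_one]
  constructor
  · intro h φ
    simpa [Character.apply_abs] using φ.monotone h
  · intro h
    refine Character.le_of_forall_apply_le fun φ => ?_
    simpa [Character.apply_abs] using h φ

/-- The transform is isometric with dense image, so approximants of `f` form a Cauchy sequence in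
`A` whose limit maps to `f`. -/
theorem gelfand_surjective {A : Type u} [CommRing A] [Lattice A] [Algebra ℝ A] [IsBal A]
    (hA : IsUniformlyComplete A) : Function.Surjective (Character.gelfand (A := A)) := by
  intro f
  choose s hs using fun n : ℕ => Character.exists_norm_gelfand_sub_lt f
    (Nat.one_div_pos_of_nat (α := ℝ) (n := n))
  have hlim : Filter.Tendsto (fun n => Character.gelfand (s n)) Filter.atTop (nhds f) := by
    rw [tendsto_iff_norm_sub_tendsto_zero]
    exact squeeze_zero (fun _ => norm_nonneg _) (fun n => (hs n).le)
      tendsto_one_div_add_atTop_nhds_zero_nat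
  obtain ⟨a, ha⟩ := hA s fun ε hε => by
    obtain ⟨N, hN⟩ := Metric.cauchySeq_iff.1 hlim.cauchySeq ε hε
    refine ⟨N, fun m n hm hn => ?_⟩
    rw [unifNorm_eq_norm_gelfand, map_sub, ← dist_eq_norm]
    exact hN m hm n hn
  refine ⟨a, tendsto_nhds_unique (Metric.tendsto_atTop.2 fun ε hε => ?_) hlim⟩
  obtain ⟨N, hN⟩ := ha ε hε
  refine ⟨N, fun n hn => ?_⟩
  rw [dist_eq_norm, ← map_sub, ← unifNorm_eq_norm_gelfand]
  exact hN n hn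

end Functions

/-! ### The two functors -/

theorem MBalD.box_zero (A : MBalD.{u}) : A.obj.box 0 = 0 :=
  A.property

/-- The frame of characters of a modal algebra. -/
def characterFrame (A : MBalD.{u}) : KHFD.{u} where
  obj :=
    { carrier := Character A.alg
      rel := modalRel A.obj.box
      isContinuousRel := isContinuousRel_modalRel A.obj.isModal A.box_zero }
  property := modalRel_serial A.obj.isModal A.box_zero

/-- The bounded morphism induced by a homomorphism of modal algebras. -/
def characterFrameMap {A B : MBalD.{u}} (α : A ⟶ B) : characterFrame B ⟶ characterFrame A :=
  ObjectProperty.homMk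
    { toMap := ⟨fun φ => φ.comp α.hom.toAlgHom α.hom.map_sup,
        Character.continuous_iff.2 fun _ => Character.continuous_apply _⟩
      image_rel := image_comp_modalRel B.obj.isModal B.box_zero α.hom.toAlgHom α.hom.map_sup
        α.hom.map_box }

/-- The functor `(A, □) ↦ (Y_A, R_□)`. -/
def yosidaFunctor : MBalD.{u} ⥤ KHFD.{u}ᵒᵖ where
  obj A := op (characterFrame A)
  map α := (characterFrameMap α).op
  map_id _ := rfl
  map_comp _ _ := rfl

/-- The modal algebra of continuous functions on a frame. -/
noncomputable def functionAlgebra (X : KHFD.{u}) : MBalD.{u} where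
  obj :=
    { carrier := C(X.space, ℝ)
      box := boxRel X.obj.isContinuousRel X.property
      isModal := isModalOperator_boxRel X.obj.isContinuousRel X.property }
  property := boxRel_zero X.obj.isContinuousRel X.property

/-- The homomorphism of modal algebras induced by a bounded morphism. -/
noncomputable def functionAlgebraMap {X X' : KHFD.{u}} (φ : X ⟶ X') :
    functionAlgebra X' ⟶ functionAlgebra X :=
  ObjectProperty.homMk
    { toAlgHom := ContinuousMap.compRightAlgHom ℝ ℝ φ.hom.toMap
      map_sup := fun _ _ => rfl
      map_inf := fun _ _ => rfl
      map_box := boxRel_comp X.obj.isContinuousRel X.property X'.obj.isContinuousRel X'.property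
        φ.hom.toMap φ.hom.image_rel }

/-- The functor `(X, R) ↦ (C(X), □_R)`. -/
noncomputable def functionFunctor : KHFD.{u}ᵒᵖ ⥤ MBalD.{u} where
  obj X := functionAlgebra X.unop
  map φ := functionAlgebraMap φ.unop
  map_id _ := rfl
  map_comp _ _ := rfl

/-! ### The adjunction -/

theorem gelfand_box (A : MBalD.{u}) (a : A.alg) :
    Character.gelfand (A.obj.box a) =
      boxRel (characterFrame A).obj.isContinuousRel (characterFrame A).property
        (Character.gelfand a) :=
  ContinuousMap.ext fun φ => (isLeast_apply_box A.obj.isModal A.box_zero φ a).unique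
    (isLeast_boxRel (characterFrame A).obj.isContinuousRel (characterFrame A).property
      (Character.gelfand a) φ)

/-- The unit `a ↦ ζ_A(a)`. -/
noncomputable def gelfandHom (A : MBalD.{u}) : A ⟶ functionAlgebra (characterFrame A) :=
  ObjectProperty.homMk
    { toAlgHom := Character.gelfand (A := A.alg)
      map_sup := fun a b => Character.gelfand_sup a b
      map_inf := fun a b => Character.gelfand_inf a b
      map_box := gelfand_box A }

/-- The counit, which sends a point to evaluation there. -/
noncomputable def evalHom (X : KHFD.{u}) : X ⟶ characterFrame (functionAlgebra X) :=
  ObjectProperty.homMk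
    { toMap := ⟨evalCharacter (X := X.space), continuous_evalCharacter⟩
      image_rel := fun x => by
        ext φ
        obtain ⟨y, rfl⟩ := evalCharacter_surjective (X := X.space) φ
        refine Iff.trans ?_
          (modalRel_evalCharacter_iff X.obj.isContinuousRel X.property x y).symm
        exact evalCharacter_injective.mem_set_image }

/-- The adjunction between modal algebras and compact Hausdorff frames. -/
noncomputable def gelfandAdjunction : yosidaFunctor.{u} ⊣ functionFunctor.{u} :=
  Adjunction.mkOfUnitCounit
    { unit := { app := gelfandHom, naturality := fun _ _ _ => rfl }
      counit := { app := fun X => (evalHom X.unop).op, naturality := fun _ _ _ => rfl }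
      left_triangle := rfl
      right_triangle := by
        ext X
        rfl }

/-- The identification of `yosidaFunctor` with the functor of maximal `ℓ`-ideals. -/
noncomputable def yosidaPresentation : YosidaPresentation yosidaFunctor.{u} where
  points _ := Character.equivMaxLIdeal
  isClosed_iff _ _ := Character.isClosed_iff_exists_lideal
  rel_iff A _ _ := modalRel_iff A.obj.isModal A.box_zero
  map_points _ _ _ := Iff.rfl

/-- The identification of `functionFunctor` with the functor of continuous functions. -/
noncomputable def functionPresentation : FunctionPresentation functionFunctor.{u} where
  functions _ := AlgEquiv.refl
  le_iff _ _ _ := Iff.rfl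
  box_apply _ _ _ := rfl
  map_functions _ _ := rfl

/-! ### The dual equivalence -/

theorem MBalD.isIso_of_bijective {A B : MBalD.{u}} (α : A ⟶ B)
    (h : Function.Bijective α.hom.toAlgHom) : IsIso α := by
  let e := AlgEquiv.ofBijective α.hom.toAlgHom h
  have he : ∀ b, α.hom.toAlgHom (e.symm b) = b := e.apply_symm_apply
  let β : B ⟶ A := ObjectProperty.homMk
    { toAlgHom := e.symm.toAlgHom
      map_sup := fun a b => h.1 ((he _).trans (by
        rw [α.hom.map_sup]
        simp only [AlgEquiv.coe_toAlgHom, he]))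
      map_inf := fun a b => h.1 ((he _).trans (by
        rw [α.hom.map_inf]
        simp only [AlgEquiv.coe_toAlgHom, he]))
      map_box := fun a => h.1 ((he _).trans (by
        rw [α.hom.map_box]
        simp only [AlgEquiv.coe_toAlgHom, he])) }
  refine ⟨β, ?_, ?_⟩
  · exact ObjectProperty.hom_ext _ (MBal.Hom.ext (AlgHom.ext e.symm_apply_apply))
  · exact ObjectProperty.hom_ext _ (MBal.Hom.ext (AlgHom.ext e.apply_symm_apply))

theorem KHFD.isIso_of_bijective {X Y : KHFD.{u}} (φ : X ⟶ Y)
    (h : Function.Bijective φ.hom.toMap) : IsIso φ := by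
  let e := φ.hom.toMap.continuous.homeoOfEquivCompactToT2 (f := Equiv.ofBijective _ h)
  have he : ∀ x, e x = φ.hom.toMap x := fun _ => rfl
  let ψ : Y ⟶ X := ObjectProperty.homMk
    { toMap := ⟨e.symm, e.symm.continuous⟩
      image_rel := fun y => by
        have h1 := φ.hom.image_rel (e.symm y)
        rw [← he, e.apply_symm_apply] at h1
        rw [← h1]
        exact e.symm_image_image _ }
  refine ⟨ψ, ?_, ?_⟩
  · exact ObjectProperty.hom_ext _ (KHF.Hom.ext (ContinuousMap.ext e.symm_apply_apply))
  · exact ObjectProperty.hom_ext _ (KHF.Hom.ext (ContinuousMap.ext e.apply_symm_apply))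

instance isIso_evalHom (X : KHFD.{u}) : IsIso (evalHom X) :=
  KHFD.isIso_of_bijective _ ⟨evalCharacter_injective (X := X.space), evalCharacter_surjective⟩

theorem isIso_gelfandHom {A : MBalD.{u}} (hA : mubalD A) : IsIso (gelfandHom A) :=
  MBalD.isIso_of_bijective _ ⟨Character.gelfand_injective, gelfand_surjective hA⟩

theorem mubalD_functionFunctor (X : KHFD.{u}ᵒᵖ) : mubalD (functionFunctor.obj X) :=
  isUniformlyComplete_continuousMap (X := X.unop.space)

/-- Included into the larger category, the restricted unit is the Gelfand transform, and a full
inclusion reflects isomorphisms. -/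
instance isIso_restrictAdjunction_unit :
    IsIso (restrictAdjunction gelfandAdjunction.{u} mubalD mubalD_functionFunctor).unit := by
  refine @NatIso.isIso_of_isIso_app _ _ _ _ _ _ _ fun A => ?_
  have h : mubalD.ι.map ((restrictAdjunction gelfandAdjunction.{u} mubalD
      mubalD_functionFunctor).unit.app A) = gelfandHom A.obj := by
    refine (gelfandAdjunction.{u}.map_restrictFullyFaithful_unit_app (L := mubalD.ι ⋙ yosidaFunctor)
      (R := mubalD.lift functionFunctor mubalD_functionFunctor) mubalD.fullyFaithfulι
      (Functor.FullyFaithful.id _) (Iso.refl _) (Iso.refl _) A).trans ?_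
    rfl
  have : IsIso (mubalD.ι.map ((restrictAdjunction gelfandAdjunction.{u} mubalD
      mubalD_functionFunctor).unit.app A)) := by
    rw [h]
    exact isIso_gelfandHom A.property
  exact isIso_of_reflects_iso _ mubalD.ι

instance isIso_restrictAdjunction_counit :
    IsIso (restrictAdjunction gelfandAdjunction.{u} mubalD mubalD_functionFunctor).counit := by
  refine @NatIso.isIso_of_isIso_app _ _ _ _ _ _ _ fun X => ?_
  have h : (restrictAdjunction gelfandAdjunction.{u} mubalD
      mubalD_functionFunctor).counit.app X = (evalHom X.unop).op := by
    rw [restrictAdjunction]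
    refine (Adjunction.map_restrictFullyFaithful_counit_app ..).trans ?_
    rfl
  rw [h]
  exact (inferInstance : IsIso (evalHom X.unop).op)

end ModalGelfand

theorem mainTheorem10 :
    ∃ (Y : MBalD.{u} ⥤ KHFD.{u}ᵒᵖ) (C : KHFD.{u}ᵒᵖ ⥤ MBalD.{u}) (adj : Y ⊣ C)
      (pY : YosidaPresentation Y) (pC : FunctionPresentation C),
      -- the unit sends `a` to the function whose value at `M` is the real `r` with `a - r ∈ M`
      (∀ (A : MBalD.{u}) (a : A.alg) (M : (Y.obj A).unop.space),
        a - algebraMap ℝ A.alg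
          (pC.functions (Y.obj A).unop ((adj.unit.app A).hom.toAlgHom a) M) ∈
            (pY.points A M).1) ∧
      -- the counit sends `x` to the maximal `ℓ`-ideal of functions vanishing at `x`
      (∀ (X : KHFD.{u}) (x : X.space) (f : (C.obj (op X)).alg),
        f ∈ (pY.points (C.obj (op X)) ((adj.counit.app (op X)).unop.hom.toMap x)).1 ↔
          pC.functions X f x = 0) ∧
      -- the adjunction restricts to a dual equivalence
      ∃ hC : ∀ X : KHFD.{u}ᵒᵖ, mubalD (C.obj X),
        IsIso (restrictAdjunction adj mubalD hC).unit ∧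
        IsIso (restrictAdjunction adj mubalD hC).counit ∧
        (mubalD.ι ⋙ Y).IsEquivalence ∧ (mubalD.lift C hC).IsEquivalence := by
  let e := (restrictAdjunction gelfandAdjunction.{u} mubalD mubalD_functionFunctor).toEquivalence
  exact ⟨yosidaFunctor, functionFunctor, gelfandAdjunction, yosidaPresentation,
    functionPresentation, fun _ a M => Character.sub_algebraMap_mem_ker M a,
    fun _ _ _ => Iff.rfl, mubalD_functionFunctor, isIso_restrictAdjunction_unit,
    isIso_restrictAdjunction_counit, e.isEquivalence_functor, e.isEquivalence_inverse⟩
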